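/- Fix a complex-valued Schwartz function $\Phi\in\mathcal S(\mathbb R)$ with $\int_{\mathbb R}\Phi(x)\,dx\neq 0$, and put $\Phi_t(x)=t^{-1}\Phi(x/t)$ for $t>0$. For $f\in L^1(\mathbb R)$ (complex-valued) let $M_\Phi f(x)=\sup_{t>0}|f*\Phi_t(x)|$ and $\|f\|_{H^1(\mathbb R)}=\int_{\mathbb R}M_\Phi f(x)\,dx\in[0,\infty]$, and let $H^1(\mathbb R)$ be the space of all $f\in L^1(\mathbb R)$ with $\|f\|_{H^1(\mathbb R)}<\infty$. Let $\varphi\in L^1(0,\infty)$ be complex-valued (in particular, $\varphi$ may be real-valued and signed). Then for every $f\in H^1(\mathbb R)$ the integral $$\mathcal H_\varphi f(x)=\int_0^\infty f\left(\frac xt\right)\frac{\varphi(t)}{t}\,dt$$ converges absolutely for almost every $x\in\mathbb R$, and the Hausdorff operator $\mathcal H_\varphi$ is bounded on $H^1(\mathbb R)$, that is, it maps $H^1(\mathbb R)$ into itself and there is a constant $C<\infty$ with $\|\mathcal H_\varphi f\|_{H^1(\mathbb R)}\le C\|f\|_{H^1(\mathbb R)}$ for all $f\in H^1(\mathbb R)$.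 Moreover, the least such constant, $\|\mathcal H_\varphi\|_{H^1(\mathbb R)\to H^1(\mathbb R)}$, satisfies $$\left|\int_0^\infty\varphi(t)\,dt\right|\le\|\mathcal H_\varphi\|_{H^1(\mathbb R)\to H^1(\mathbb R)}\le\int_0^\infty|\varphi(t)|\,dt.$$ -/

import Mathlib

open MeasureTheory Set
open scoped SchwartzMap ENNReal NNReal Convolution

noncomputable section

/-- The dilation `Φ_t(x) = t⁻¹ Φ(x / t)` of a function on the line. -/
def dilation (Φ : ℝ → ℂ) (t : ℝ) (x : ℝ) : ℂ := (t : ℂ)⁻¹ * Φ (x / t)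

/-- The smooth maximal function `M_Φ f(x) = sup_{t > 0} |(f * Φ_t)(x)|`, with values in `[0, ∞]`. -/
def smoothMaximal (Φ : 𝓢(ℝ, ℂ)) (f : ℝ → ℂ) (x : ℝ) : ℝ≥0∞ :=
  ⨆ (t : ℝ) (_ : 0 < t), ‖(f ⋆[ContinuousLinearMap.mul ℂ ℂ, volume] dilation Φ t) x‖ₑ

/-- The Hardy norm `‖f‖_{H¹} = ‖M_Φ f‖_{L¹}`, with values in `[0, ∞]`. -/
def hardyNorm (Φ : 𝓢(ℝ, ℂ)) (f : ℝ → ℂ) : ℝ≥0∞ := ∫⁻ x, smoothMaximal Φ f x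

/-- `f` (as a representative of its almost-everywhere class) belongs to `H¹(ℝ)`:
it is integrable and its Hardy norm is finite. -/
def MemHardy (Φ : 𝓢(ℝ, ℂ)) (f : ℝ → ℂ) : Prop :=
  Integrable f ∧ hardyNorm Φ f < ∞

/-- The Hausdorff operator `H_φ f(x) = ∫₀^∞ f(x / t) φ(t) / t dt`. -/
def hausdorffOp (φ : ℝ → ℂ) (f : ℝ → ℂ) (x : ℝ) : ℂ :=
  ∫ t in Ioi (0 : ℝ), f (x / t) * (φ t / (t : ℂ))

/-- `T` maps `H¹(ℝ)` into itself and is bounded for the Hardy norm. -/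
def BoundedOnHardy (Φ : 𝓢(ℝ, ℂ)) (T : (ℝ → ℂ) → (ℝ → ℂ)) : Prop :=
  ∃ C : ℝ≥0, ∀ f, MemHardy Φ f → MemHardy Φ (T f) ∧ hardyNorm Φ (T f) ≤ C * hardyNorm Φ f

/-- The operator norm `‖T‖_{H¹ → H¹}`: the least `C` in `[0, ∞]` with
`‖T f‖_{H¹} ≤ C ‖f‖_{H¹}` for all `f` in `H¹(ℝ)`. -/
def hardyOpNorm (Φ : 𝓢(ℝ, ℂ)) (T : (ℝ → ℂ) → (ℝ → ℂ)) : ℝ≥0∞ :=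
  sInf {C : ℝ≥0∞ | ∀ f, MemHardy Φ f → hardyNorm Φ (T f) ≤ C * hardyNorm Φ f}

end

open Filter Topology

/-! ### Dilations and the smooth maximal function -/

/-! Since `f (x / t) / t` is the dilate `f_t`, the Hausdorff operator is the average `∫ φ(t) f_t
dt`. Dilations are contractions for the Hardy norm (`hardyNorm_dilation_le`), so Minkowski's
inequality gives the upper bound.

For the lower bound, approximate eigenvectors with eigenvalue `∫ φ` are needed, i.e. functions that
dilations almost fix. The kernel `1/x` is exactly dilation invariant but not in `H¹`; cut off to `1
< |x| ≤ R` it is bounded, odd and compactly supported, hence in `H¹`. The defect `f_t - f` has Hardy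
norm bounded independently of `R` (`hardyNorm_dilation_truncatedInv_sub_le`), while `‖f‖` is at
least `|∫ Φ| log R` (`le_hardyNorm_truncatedInv`), which is unbounded because `∫ Φ ≠ 0`. Dividing by
`‖f‖` and letting `R → ∞`, dominated convergence removes the defect. -/

lemma convolution_dilation_apply (Φ : 𝓢(ℝ, ℂ)) (f : ℝ → ℂ) (s x : ℝ) :
    (f ⋆[ContinuousLinearMap.mul ℂ ℂ, volume] dilation Φ s) x
      = ∫ y, f y * dilation Φ s (x - y) := by
  simp [convolution_def]

lemma continuous_dilation (Φ : 𝓢(ℝ, ℂ)) (s : ℝ) : Continuous (dilation Φ s) := by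
  unfold dilation
  exact continuous_const.mul (Φ.continuous.comp (continuous_id.div_const s))

lemma exists_norm_dilation_le (Φ : 𝓢(ℝ, ℂ)) (s : ℝ) : ∃ B, ∀ y, ‖dilation Φ s y‖ ≤ B := by
  obtain ⟨C, -, hC⟩ := Φ.decay 0 0
  refine ⟨‖(s : ℂ)⁻¹‖ * C, fun y => ?_⟩
  rw [dilation, norm_mul]
  gcongr
  simpa using hC (y / s)

lemma integrable_mul_dilation_comp (Φ : 𝓢(ℝ, ℂ)) {f : ℝ → ℂ} (hf : Integrable f) (s : ℝ)
    {u : ℝ → ℝ} (hu : Continuous u) : Integrable fun y => f y * dilation Φ s (u y) := by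
  obtain ⟨B, hB⟩ := exists_norm_dilation_le Φ s
  exact hf.mul_bdd ((continuous_dilation Φ s).comp hu).aestronglyMeasurable
    (Eventually.of_forall fun y => hB _)

lemma integrable_dilation {f : ℝ → ℂ} (hf : Integrable f) {t : ℝ} (ht : t ≠ 0) :
    Integrable (dilation f t) :=
  (hf.comp_div ht).const_mul _

lemma integral_dilation_mul (f ψ : ℝ → ℂ) {t : ℝ} (ht : 0 < t) :
    ∫ y, dilation f t y * ψ y = ∫ u, f u * ψ (t * u) := by
  have h := Measure.integral_comp_div (fun u => (t : ℂ)⁻¹ * (f u * ψ (t * u))) t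
  rw [abs_of_pos ht, integral_const_mul _ (fun u => f u * ψ (t * u))] at h
  have h2 : (∫ y, dilation f t y * ψ y)
      = ∫ y, (t : ℂ)⁻¹ * (f (y / t) * ψ (t * (y / t))) := by
    congr 1; ext y
    rw [mul_div_cancel₀ _ ht.ne', dilation, mul_assoc]
  have ht' : (t : ℂ) ≠ 0 := by exact_mod_cast ht.ne'
  rw [h2, h, Complex.real_smul, mul_inv_cancel_left₀ ht']

/-- Moving `t` from `f` onto the smooth kernel makes the expression jointly continuous in `(x, t)`
for merely integrable `f`. -/
lemma convolution_dilation_dilation (Φ : 𝓢(ℝ, ℂ)) (f : ℝ → ℂ) {s t : ℝ} (ht : 0 < t) (x : ℝ) :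
    (dilation f t ⋆[ContinuousLinearMap.mul ℂ ℂ, volume] dilation Φ s) x
      = ∫ u, f u * dilation Φ s (x - t * u) := by
  rw [convolution_dilation_apply,
    integral_dilation_mul f (fun y => dilation Φ s (x - y)) ht]

lemma continuous_integral_mul_dilation (Φ : 𝓢(ℝ, ℂ)) {f : ℝ → ℂ} (hf : Integrable f) (s : ℝ) :
    Continuous fun p : ℝ × ℝ => ∫ u, f u * dilation Φ s (p.1 - p.2 * u) := by
  obtain ⟨B, hB⟩ := exists_norm_dilation_le Φ s
  refine continuous_of_dominated (bound := fun u => ‖f u‖ * B) (fun p => ?_) (fun p => ?_)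
    (hf.norm.mul_const B) ?_
  · exact (integrable_mul_dilation_comp Φ hf s (by fun_prop)).aestronglyMeasurable
  · refine Eventually.of_forall fun u => ?_
    rw [norm_mul]
    gcongr
    exact hB _
  · refine Eventually.of_forall fun u => continuous_const.mul ?_
    exact (continuous_dilation Φ s).comp (by fun_prop)

lemma continuous_integral_sub_mul_dilation (Φ : 𝓢(ℝ, ℂ)) {f : ℝ → ℂ} (hf : Integrable f) (s : ℝ) :
    Continuous fun x : ℝ => ∫ u, f u * dilation Φ s (x - u) := by
  have h : Continuous fun x : ℝ => (x, (1 : ℝ)) := by fun_prop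
  simpa only [Function.comp_def, one_mul] using
    (continuous_integral_mul_dilation Φ hf s).comp h

lemma convolution_add_left (Φ : 𝓢(ℝ, ℂ)) {f g : ℝ → ℂ} (hf : Integrable f) (hg : Integrable g)
    (s x : ℝ) :
    ((f + g) ⋆[ContinuousLinearMap.mul ℂ ℂ, volume] dilation Φ s) x
      = (f ⋆[ContinuousLinearMap.mul ℂ ℂ, volume] dilation Φ s) x
        + (g ⋆[ContinuousLinearMap.mul ℂ ℂ, volume] dilation Φ s) x := by
  simp only [convolution_dilation_apply, Pi.add_apply, add_mul]
  exact integral_add (integrable_mul_dilation_comp Φ hf s (by fun_prop))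
    (integrable_mul_dilation_comp Φ hg s (by fun_prop))

lemma convolution_smul_left (Φ : 𝓢(ℝ, ℂ)) (c : ℂ) (f : ℝ → ℂ) (s x : ℝ) :
    ((c • f) ⋆[ContinuousLinearMap.mul ℂ ℂ, volume] dilation Φ s) x
      = c * (f ⋆[ContinuousLinearMap.mul ℂ ℂ, volume] dilation Φ s) x := by
  simp only [convolution_dilation_apply, Pi.smul_apply, smul_eq_mul, mul_assoc]
  exact integral_const_mul _ _

/-- The maximal function of `dilation f t + c • f`, as a function of `(x, t)`, is
measurable on `t > 0`. -/
lemma aemeasurable_smoothMaximal_dilation_add (Φ : 𝓢(ℝ, ℂ)) {f : ℝ → ℂ} (hf : Integrable f)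
    (c : ℂ) :
    AEMeasurable (fun p : ℝ × ℝ => smoothMaximal Φ (dilation f p.2 + c • f) p.1)
      (volume.prod (volume.restrict (Ioi 0))) := by
  have hm : Measurable fun p : ℝ × ℝ => ⨆ (s : ℝ) (_ : 0 < s),
      ‖(∫ u, f u * dilation Φ s (p.1 - p.2 * u)) +
        c * ∫ u, f u * dilation Φ s (p.1 - u)‖ₑ := by
    -- The supremum is uncountable, but a supremum of continuous functions is lower semicontinuous.
    refine LowerSemicontinuous.measurable (lowerSemicontinuous_biSup fun s _ => ?_)
    refine Continuous.lowerSemicontinuous (Continuous.enorm (Continuous.add ?_ ?_))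
    · exact continuous_integral_mul_dilation Φ hf s
    · exact continuous_const.mul ((continuous_integral_sub_mul_dilation Φ hf s).comp continuous_fst)
  refine ⟨_, hm, ?_⟩
  have hpos : ∀ᵐ p : ℝ × ℝ ∂(volume.prod (volume.restrict (Ioi 0))), 0 < p.2 :=
    Measure.quasiMeasurePreserving_snd.ae (ae_restrict_mem measurableSet_Ioi)
  filter_upwards [hpos] with p hp
  unfold smoothMaximal
  refine iSup_congr fun s => iSup_congr fun _ => ?_
  rw [convolution_add_left Φ (integrable_dilation hf hp.ne') (hf.smul c),
    convolution_smul_left, convolution_dilation_dilation Φ f hp, convolution_dilation_apply]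

lemma measurable_smoothMaximal (Φ : 𝓢(ℝ, ℂ)) {f : ℝ → ℂ} (hf : Integrable f) :
    Measurable (smoothMaximal Φ f) := by
  refine LowerSemicontinuous.measurable (lowerSemicontinuous_biSup fun s _ => ?_)
  refine Continuous.lowerSemicontinuous (Continuous.enorm ?_)
  simp only [funext fun x => convolution_dilation_apply Φ f s x]
  exact continuous_integral_sub_mul_dilation Φ hf s

lemma smoothMaximal_add_le (Φ : 𝓢(ℝ, ℂ)) {f g : ℝ → ℂ} (hf : Integrable f) (hg : Integrable g)
    (x : ℝ) : smoothMaximal Φ (f + g) x ≤ smoothMaximal Φ f x + smoothMaximal Φ g x := by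
  refine iSup₂_le fun s hs => ?_
  rw [convolution_add_left Φ hf hg]
  refine (enorm_add_le _ _).trans (add_le_add ?_ ?_)
  · exact le_iSup₂ (f := fun (t : ℝ) (_ : 0 < t) =>
      ‖(f ⋆[ContinuousLinearMap.mul ℂ ℂ, volume] dilation Φ t) x‖ₑ) s hs
  · exact le_iSup₂ (f := fun (t : ℝ) (_ : 0 < t) =>
      ‖(g ⋆[ContinuousLinearMap.mul ℂ ℂ, volume] dilation Φ t) x‖ₑ) s hs

lemma smoothMaximal_smul (Φ : 𝓢(ℝ, ℂ)) (c : ℂ) (f : ℝ → ℂ) (x : ℝ) :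
    smoothMaximal Φ (c • f) x = ‖c‖ₑ * smoothMaximal Φ f x := by
  simp only [smoothMaximal, convolution_smul_left, enorm_mul, ENNReal.mul_iSup]

/-! ### The Hardy norm -/

lemma hardyNorm_add_le (Φ : 𝓢(ℝ, ℂ)) {f g : ℝ → ℂ} (hf : Integrable f) (hg : Integrable g) :
    hardyNorm Φ (f + g) ≤ hardyNorm Φ f + hardyNorm Φ g := by
  unfold hardyNorm
  rw [← lintegral_add_left (measurable_smoothMaximal Φ hf)]
  exact lintegral_mono fun x => smoothMaximal_add_le Φ hf hg x

lemma hardyNorm_smul (Φ : 𝓢(ℝ, ℂ)) (c : ℂ) (f : ℝ → ℂ) :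
    hardyNorm Φ (c • f) = ‖c‖ₑ * hardyNorm Φ f := by
  simp only [hardyNorm, smoothMaximal_smul]
  exact lintegral_const_mul' _ _ enorm_ne_top

lemma hardyNorm_sub_le (Φ : 𝓢(ℝ, ℂ)) {f g : ℝ → ℂ} (hf : Integrable f) (hg : Integrable g) :
    hardyNorm Φ (f - g) ≤ hardyNorm Φ f + hardyNorm Φ g := by
  have h := hardyNorm_add_le Φ hf (hg.smul (-1 : ℂ))
  rw [hardyNorm_smul] at h
  simpa [sub_eq_add_neg] using h

/-- Scaling gives `f_t * Φ_s = (f * Φ_{s/t})_t`, and `s / t` again ranges over the positive scales.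
-/
lemma smoothMaximal_dilation_le (Φ : 𝓢(ℝ, ℂ)) (f : ℝ → ℂ) {t : ℝ} (ht : 0 < t) (x : ℝ) :
    smoothMaximal Φ (dilation f t) x ≤ ENNReal.ofReal t⁻¹ * smoothMaximal Φ f (x / t) := by
  have ht' : (t : ℂ) ≠ 0 := by exact_mod_cast ht.ne'
  refine iSup₂_le fun s hs => ?_
  have key : (dilation f t ⋆[ContinuousLinearMap.mul ℂ ℂ, volume] dilation Φ s) x
      = (t : ℂ)⁻¹ * (f ⋆[ContinuousLinearMap.mul ℂ ℂ, volume] dilation Φ (s / t)) (x / t) := by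
    rw [convolution_dilation_dilation Φ f ht, convolution_dilation_apply, ← integral_const_mul]
    congr 1; ext u
    have h1 : (x - t * u) / s = (x / t - u) / (s / t) := by field_simp
    simp only [dilation]
    rw [h1]
    push_cast
    field_simp
  have h2 : ‖(t : ℂ)⁻¹‖ₑ = ENNReal.ofReal t⁻¹ := by
    rw [← ofReal_norm, norm_inv, Complex.norm_of_nonneg ht.le]
  rw [key, enorm_mul, h2]
  gcongr
  exact le_iSup₂ (f := fun (r : ℝ) (_ : 0 < r) =>
      ‖(f ⋆[ContinuousLinearMap.mul ℂ ℂ, volume] dilation Φ r) (x / t)‖ₑ) (s / t) (div_pos hs ht)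

lemma lintegral_comp_div_of_pos {g : ℝ → ℝ≥0∞} (hg : Measurable g) {t : ℝ} (ht : 0 < t) :
    ∫⁻ x, g (x / t) = ENNReal.ofReal t * ∫⁻ x, g x := by
  have h := lintegral_map (μ := volume) hg (measurable_const_mul t⁻¹)
  rw [Real.map_volume_mul_left (inv_ne_zero ht.ne'), lintegral_smul_measure, inv_inv,
    abs_of_pos ht] at h
  simp only [div_eq_inv_mul]
  exact h.symm

lemma hardyNorm_dilation_le (Φ : 𝓢(ℝ, ℂ)) {f : ℝ → ℂ} (hf : Integrable f) {t : ℝ} (ht : 0 < t) :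
    hardyNorm Φ (dilation f t) ≤ hardyNorm Φ f := by
  calc hardyNorm Φ (dilation f t)
      ≤ ∫⁻ x, ENNReal.ofReal t⁻¹ * smoothMaximal Φ f (x / t) :=
        lintegral_mono fun x => smoothMaximal_dilation_le Φ f ht x
    _ = hardyNorm Φ f := by
        rw [lintegral_const_mul' _ _ ENNReal.ofReal_ne_top,
          lintegral_comp_div_of_pos (measurable_smoothMaximal Φ hf) ht, ← mul_assoc,
          ← ENNReal.ofReal_mul (inv_nonneg.2 ht.le), inv_mul_cancel₀ ht.ne',
          ENNReal.ofReal_one, one_mul, hardyNorm]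

/-! ### The Hausdorff operator as an average of dilations -/

lemma quasiMeasurePreserving_div_Ioi :
    Measure.QuasiMeasurePreserving (fun p : ℝ × ℝ => p.1 / p.2)
      (volume.prod (volume.restrict (Ioi 0))) volume := by
  refine QuasiMeasurePreserving.prod_of_left (measurable_fst.div measurable_snd) ?_
  filter_upwards [ae_restrict_mem measurableSet_Ioi] with t ht
  have h := Measure.quasiMeasurePreserving_smul (volume : Measure ℝ)
    (inv_ne_zero (ne_of_gt (mem_Ioi.1 ht)))
  simpa only [smul_eq_mul, div_eq_inv_mul] using h

/-- Tonelli: integrating in `x` first produces a factor `t` that cancels the `1 / t`, leaving `‖φ t‖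
* ‖f‖₁`. -/
lemma integrable_hausdorff_kernel {φ f : ℝ → ℂ} (hφ : IntegrableOn φ (Ioi 0))
    (hf : Integrable f) :
    Integrable (fun p : ℝ × ℝ => f (p.1 / p.2) * (φ p.2 / (p.2 : ℂ)))
      (volume.prod (volume.restrict (Ioi 0))) := by
  have hm : AEStronglyMeasurable (fun p : ℝ × ℝ => f (p.1 / p.2) * (φ p.2 / (p.2 : ℂ)))
      (volume.prod (volume.restrict (Ioi 0))) := by
    refine (hf.aestronglyMeasurable.comp_quasiMeasurePreserving
      quasiMeasurePreserving_div_Ioi).mul ?_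
    have h : AEStronglyMeasurable (fun t : ℝ => φ t / (t : ℂ)) (volume.restrict (Ioi 0)) :=
      (hφ.aestronglyMeasurable.aemeasurable.div
        Complex.measurable_ofReal.aemeasurable).aestronglyMeasurable
    exact h.comp_quasiMeasurePreserving Measure.quasiMeasurePreserving_snd
  rw [integrable_prod_iff' hm]
  constructor
  · filter_upwards [ae_restrict_mem measurableSet_Ioi] with t ht
    exact (hf.comp_div (ne_of_gt (mem_Ioi.1 ht))).mul_const _
  · refine ((hφ.norm.mul_const (∫ y, ‖f y‖)).congr ?_)
    filter_upwards [ae_restrict_mem measurableSet_Ioi] with t ht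
    have ht : 0 < t := ht
    simp only [norm_mul, norm_div, Complex.norm_real, Real.norm_eq_abs]
    rw [integral_mul_const, Measure.integral_comp_div (fun y => ‖f y‖), smul_eq_mul,
      abs_of_pos ht]
    field_simp

lemma integrable_hausdorffOp {φ f : ℝ → ℂ} (hφ : IntegrableOn φ (Ioi 0))
    (hf : Integrable f) : Integrable (hausdorffOp φ f) :=
  (integrable_hausdorff_kernel hφ hf).integral_prod_left

lemma convolution_hausdorffOp (Φ : 𝓢(ℝ, ℂ)) {φ f : ℝ → ℂ} (hφ : IntegrableOn φ (Ioi 0))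
    (hf : Integrable f) (s x : ℝ) :
    IntegrableOn (fun t => φ t *
      (dilation f t ⋆[ContinuousLinearMap.mul ℂ ℂ, volume] dilation Φ s) x) (Ioi 0) ∧
    (hausdorffOp φ f ⋆[ContinuousLinearMap.mul ℂ ℂ, volume] dilation Φ s) x
      = ∫ t in Ioi (0 : ℝ), φ t *
        (dilation f t ⋆[ContinuousLinearMap.mul ℂ ℂ, volume] dilation Φ s) x := by
  obtain ⟨B, hB⟩ := exists_norm_dilation_le Φ s
  have hint : Integrable (fun p : ℝ × ℝ => f (p.1 / p.2) * (φ p.2 / (p.2 : ℂ))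
      * dilation Φ s (x - p.1)) (volume.prod (volume.restrict (Ioi 0))) := by
    refine (integrable_hausdorff_kernel hφ hf).mul_bdd (c := B) ?_
      (Eventually.of_forall fun p => hB _)
    exact ((continuous_dilation Φ s).comp (continuous_const.sub continuous_fst)).aestronglyMeasurable
  have hslice : ∀ t : ℝ, ∫ y, f (y / t) * (φ t / (t : ℂ)) * dilation Φ s (x - y)
      = φ t * (dilation f t ⋆[ContinuousLinearMap.mul ℂ ℂ, volume] dilation Φ s) x := by
    intro t
    rw [convolution_dilation_apply, ← integral_const_mul]
    congr 1; ext y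
    rw [show dilation f t y = (t : ℂ)⁻¹ * f (y / t) from rfl]
    ring
  constructor
  · have h := hint.integral_prod_right
    simp only [hslice] at h
    exact h
  · simp only [convolution_dilation_apply Φ (hausdorffOp φ f), hausdorffOp, ← integral_mul_const]
    rw [integral_integral_swap hint]
    simp only [hslice]

/-- Minkowski's inequality for the Hausdorff operator, corrected by a multiple of `f`. -/
lemma hardyNorm_hausdorffOp_add_le (Φ : 𝓢(ℝ, ℂ)) {φ f : ℝ → ℂ} (hφ : IntegrableOn φ (Ioi 0))
    (hf : Integrable f) (c : ℂ) :
    hardyNorm Φ (hausdorffOp φ f + (c * ∫ t in Ioi (0 : ℝ), φ t) • f)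
      ≤ ∫⁻ t in Ioi (0 : ℝ), ‖φ t‖ₑ * hardyNorm Φ (dilation f t + c • f) := by
  have hpt : ∀ x, smoothMaximal Φ (hausdorffOp φ f + (c * ∫ t in Ioi (0 : ℝ), φ t) • f) x
      ≤ ∫⁻ t in Ioi (0 : ℝ), ‖φ t‖ₑ * smoothMaximal Φ (dilation f t + c • f) x := by
    intro x
    refine iSup₂_le fun s hs => ?_
    obtain ⟨hint, heq⟩ := convolution_hausdorffOp Φ hφ hf s x
    -- The multiple of `f` is itself the average of `c • f` against `φ`, so both terms merge into
    -- one integral over `t`.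
    have hrw : ((hausdorffOp φ f + (c * ∫ t in Ioi (0 : ℝ), φ t) • f)
          ⋆[ContinuousLinearMap.mul ℂ ℂ, volume] dilation Φ s) x
        = ∫ t in Ioi (0 : ℝ), φ t * ((dilation f t + c • f)
          ⋆[ContinuousLinearMap.mul ℂ ℂ, volume] dilation Φ s) x := by
      rw [convolution_add_left Φ (integrable_hausdorffOp hφ hf) (hf.smul _),
        convolution_smul_left, heq, mul_assoc, mul_left_comm, ← integral_mul_const,
        ← integral_add hint (hφ.mul_const _)]
      refine setIntegral_congr_fun measurableSet_Ioi fun t ht => ?_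
      have ht : 0 < t := ht
      rw [convolution_add_left Φ (integrable_dilation hf ht.ne') (hf.smul _),
        convolution_smul_left]
      ring
    rw [hrw]
    refine (enorm_integral_le_lintegral_enorm _).trans (lintegral_mono fun t => ?_)
    rw [enorm_mul]
    gcongr
    exact le_iSup₂ (f := fun (r : ℝ) (_ : 0 < r) => ‖((dilation f t + c • f)
      ⋆[ContinuousLinearMap.mul ℂ ℂ, volume] dilation Φ r) x‖ₑ) s hs
  have hφm : AEMeasurable (fun p : ℝ × ℝ => ‖φ p.2‖ₑ)
      (volume.prod (volume.restrict (Ioi 0))) :=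
    (hφ.aestronglyMeasurable.comp_quasiMeasurePreserving
      Measure.quasiMeasurePreserving_snd).enorm
  calc hardyNorm Φ (hausdorffOp φ f + (c * ∫ t in Ioi (0 : ℝ), φ t) • f)
      ≤ ∫⁻ x, ∫⁻ t in Ioi (0 : ℝ), ‖φ t‖ₑ * smoothMaximal Φ (dilation f t + c • f) x :=
        lintegral_mono hpt
    _ = ∫⁻ t in Ioi (0 : ℝ), ∫⁻ x, ‖φ t‖ₑ * smoothMaximal Φ (dilation f t + c • f) x :=
        lintegral_lintegral_swap (hφm.mul (aemeasurable_smoothMaximal_dilation_add Φ hf c))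
    _ = _ := lintegral_congr fun t => lintegral_const_mul' _ _ enorm_ne_top

lemma hardyNorm_hausdorffOp_le (Φ : 𝓢(ℝ, ℂ)) {φ f : ℝ → ℂ} (hφ : IntegrableOn φ (Ioi 0))
    (hf : Integrable f) :
    hardyNorm Φ (hausdorffOp φ f) ≤ (∫⁻ t in Ioi (0 : ℝ), ‖φ t‖ₑ) * hardyNorm Φ f := by
  have h := hardyNorm_hausdorffOp_add_le Φ hφ hf 0
  simp only [zero_mul, zero_smul, add_zero] at h
  refine h.trans ?_
  rw [← lintegral_mul_const'' _ hφ.aestronglyMeasurable.enorm]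
  refine setLIntegral_mono' measurableSet_Ioi fun t ht => ?_
  gcongr
  exact hardyNorm_dilation_le Φ hf ht

/-! ### Bounded functions of mean zero and compact support -/

lemma integral_norm_dilation (Φ : 𝓢(ℝ, ℂ)) {s : ℝ} (hs : 0 < s) :
    ∫ y, ‖dilation Φ s y‖ = ∫ y, ‖Φ y‖ := by
  simp only [dilation, norm_mul, norm_inv, Complex.norm_of_nonneg hs.le]
  rw [integral_const_mul, Measure.integral_comp_div (fun y => ‖Φ y‖), abs_of_pos hs, smul_eq_mul,
    inv_mul_cancel_left₀ hs.ne']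

lemma integrable_dilation_schwartz (Φ : 𝓢(ℝ, ℂ)) {s : ℝ} (hs : 0 < s) :
    Integrable (dilation Φ s) :=
  integrable_dilation Φ.integrable hs.ne'

lemma norm_convolution_le_of_bounded (Φ : 𝓢(ℝ, ℂ)) {g : ℝ → ℂ} {B : ℝ} (hB : ∀ y, ‖g y‖ ≤ B)
    {s : ℝ} (hs : 0 < s) (x : ℝ) :
    ‖(g ⋆[ContinuousLinearMap.mul ℂ ℂ, volume] dilation Φ s) x‖ ≤ B * ∫ y, ‖Φ y‖ := by
  rw [convolution_dilation_apply, ← integral_norm_dilation Φ hs,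
    ← integral_sub_left_eq_self (fun y => ‖dilation Φ s y‖) volume x, ← integral_const_mul]
  refine norm_integral_le_of_norm_le
    ((((integrable_dilation_schwartz Φ hs).comp_sub_left x).norm).const_mul B)
    (Eventually.of_forall fun y => ?_)
  rw [norm_mul]
  gcongr
  exact hB y

/-- Regularity of the dilates of a Schwartz function, uniform in the scale. -/
lemma exists_norm_dilation_sub_le (Φ : 𝓢(ℝ, ℂ)) : ∃ D, 0 < D ∧ ∀ s x y : ℝ, 0 < s → x ≠ 0 →
    2 * |y| ≤ |x| → ‖dilation Φ s (x - y) - dilation Φ s x‖ ≤ D * |y| / x ^ 2 := by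
  obtain ⟨D, hD, hdec⟩ := Φ.decay 2 1
  refine ⟨4 * D, by positivity, fun s x y hs hx hxy => ?_⟩
  have hder : ∀ u : ℝ, u ^ 2 * ‖deriv Φ u‖ ≤ D := by
    intro u
    have h := hdec u
    rwa [norm_iteratedFDeriv_eq_norm_iteratedDeriv, iteratedDeriv_one, Real.norm_eq_abs,
      sq_abs] at h
  -- Every `u` between `x / s` and `(x - y) / s` has `|u| ≥ |x| / (2 * s)`, so the decay of `u ^ 2 *
  -- Φ'(u)` bounds the derivative there. The factor `s ^ 2` later cancels one `s⁻¹` from the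
  -- dilation and one from `|y| / s`.
  have hmv : ‖Φ ((x - y) / s) - Φ (x / s)‖ ≤ 4 * D * s ^ 2 / x ^ 2 * ‖(x - y) / s - x / s‖ := by
    refine Convex.norm_image_sub_le_of_norm_deriv_le (s := uIcc (x / s) ((x - y) / s))
      (fun u _ => Φ.differentiable u) (fun u hu => ?_) (convex_uIcc _ _)
      left_mem_uIcc right_mem_uIcc
    have hu1 : |u - x / s| ≤ |(x - y) / s - x / s| := abs_sub_left_of_mem_uIcc hu
    have h1 : (x - y) / s - x / s = -(y / s) := by ring
    rw [h1, abs_neg, abs_div, abs_of_pos hs] at hu1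
    have h2 : |x / s| - |u| ≤ |u - x / s| := by
      rw [abs_sub_comm]; exact abs_sub_abs_le_abs_sub _ _
    rw [abs_div, abs_of_pos hs] at h2
    have h3 : |y| / s ≤ |x| / s / 2 := by
      rw [div_right_comm]; gcongr; linarith
    have h4 : |x| / s / 2 ≤ |u| := by linarith
    have h5 : x ^ 2 ≤ 4 * s ^ 2 * u ^ 2 := by
      have h6 : |x| ≤ 2 * s * |u| := by
        have := mul_le_mul_of_nonneg_left h4 (by positivity : 0 ≤ 2 * s)
        calc |x| = 2 * s * (|x| / s / 2) := by field_simp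
          _ ≤ _ := this
      calc x ^ 2 = |x| ^ 2 := (sq_abs x).symm
        _ ≤ (2 * s * |u|) ^ 2 := by gcongr
        _ = _ := by rw [mul_pow, sq_abs]; ring
    rw [le_div_iff₀ (by positivity)]
    calc ‖deriv Φ u‖ * x ^ 2 ≤ ‖deriv Φ u‖ * (4 * s ^ 2 * u ^ 2) := by gcongr
      _ = 4 * s ^ 2 * (u ^ 2 * ‖deriv Φ u‖) := by ring
      _ ≤ 4 * s ^ 2 * D := by gcongr; exact hder u
      _ = 4 * D * s ^ 2 := by ring
  have h1 : (x - y) / s - x / s = -(y / s) := by ring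
  rw [h1, norm_neg, Real.norm_eq_abs, abs_div, abs_of_pos hs] at hmv
  simp only [dilation]
  rw [← mul_sub, norm_mul, norm_inv, Complex.norm_of_nonneg hs.le]
  calc s⁻¹ * ‖Φ ((x - y) / s) - Φ (x / s)‖
      ≤ s⁻¹ * (4 * D * s ^ 2 / x ^ 2 * (|y| / s)) := by gcongr
    _ = 4 * D * |y| / x ^ 2 := by field_simp

/-- Mean zero permits subtracting the constant `Φ_s(x)` from the kernel; its regularity then gives
decay `x⁻²`, uniformly in `s`. -/
lemma norm_convolution_le_of_mean_zero (Φ : 𝓢(ℝ, ℂ)) {D : ℝ} (hD0 : 0 < D)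
    (hD : ∀ s x y : ℝ, 0 < s → x ≠ 0 →
      2 * |y| ≤ |x| → ‖dilation Φ s (x - y) - dilation Φ s x‖ ≤ D * |y| / x ^ 2)
    {g : ℝ → ℂ} (hg : Integrable g) (h0 : ∫ y, g y = 0) {R : ℝ}
    (hR : ∀ y, R < |y| → g y = 0) {s x : ℝ} (hs : 0 < s) (hx0 : x ≠ 0) (hx : 2 * R ≤ |x|) :
    ‖(g ⋆[ContinuousLinearMap.mul ℂ ℂ, volume] dilation Φ s) x‖
      ≤ (∫ y, ‖g y‖) * (D * R / x ^ 2) := by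
  have hrw : (g ⋆[ContinuousLinearMap.mul ℂ ℂ, volume] dilation Φ s) x
      = ∫ y, g y * (dilation Φ s (x - y) - dilation Φ s x) := by
    simp only [mul_sub]
    rw [integral_sub (integrable_mul_dilation_comp Φ hg s (by fun_prop)) (hg.mul_const _),
      integral_mul_const, h0, zero_mul, sub_zero, convolution_dilation_apply]
  rw [hrw, ← integral_mul_const]
  refine norm_integral_le_of_norm_le (hg.norm.mul_const _) (Eventually.of_forall fun y => ?_)
  rw [norm_mul]
  by_cases hy : R < |y|
  · simp [hR y hy]
  · push Not at hy
    gcongr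
    exact (hD s x y hs hx0 (by linarith)).trans (by gcongr)

/-- Multiples of atoms belong to the Hardy space. -/
lemma hardyNorm_lt_top_of_bounded_of_mean_zero (Φ : 𝓢(ℝ, ℂ)) {g : ℝ → ℂ} (hg : Integrable g)
    (h0 : ∫ y, g y = 0) {B R : ℝ} (hB : ∀ y, ‖g y‖ ≤ B) (hR1 : 1 ≤ R)
    (hR : ∀ y, R < |y| → g y = 0) : hardyNorm Φ g < ∞ := by
  obtain ⟨D, hD0, hD⟩ := exists_norm_dilation_sub_le Φ
  have hB0 : 0 ≤ B := (norm_nonneg _).trans (hB 0)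
  set P := B * ∫ y, ‖Φ y‖ with hP
  have hP0 : 0 ≤ P := mul_nonneg hB0 (integral_nonneg fun _ => norm_nonneg _)
  set Q := (∫ y, ‖g y‖) * (D * R) with hQ
  have hQ0 : 0 ≤ Q := by
    have : 0 ≤ ∫ y, ‖g y‖ := integral_nonneg fun _ => norm_nonneg _
    positivity
  -- The two terms serve `|x| ≤ 2 * R`, where `1 + x ^ 2 ≤ 1 + 4 * R ^ 2`, and `|x| ≥ 2 * R`, where
  -- `1 + x ^ 2 ≤ 2 * x ^ 2`.
  set K := P * (1 + 4 * R ^ 2) + 2 * Q with hK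
  have hpt : ∀ x, smoothMaximal Φ g x ≤ ENNReal.ofReal (K * (1 + x ^ 2)⁻¹) := by
    intro x
    refine iSup₂_le fun s hs => ?_
    rw [← ofReal_norm]
    refine ENNReal.ofReal_le_ofReal ?_
    rw [← div_eq_mul_inv, le_div_iff₀ (by positivity)]
    rcases le_total (2 * R) |x| with hx | hx
    · have hx1 : 1 ≤ x ^ 2 := by
        rw [← sq_abs]; nlinarith
      have hx0 : x ≠ 0 := by rintro rfl; norm_num at hx1
      have h := norm_convolution_le_of_mean_zero Φ hD0 hD hg h0 hR hs hx0 hx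
      calc _ ≤ (∫ y, ‖g y‖) * (D * R / x ^ 2) * (2 * x ^ 2) := by gcongr; linarith
        _ = 2 * Q := by rw [hQ]; field_simp
        _ ≤ K := by rw [hK]; nlinarith [mul_nonneg hP0 (by positivity : 0 ≤ 1 + 4 * R ^ 2)]
    · have h := norm_convolution_le_of_bounded Φ hB hs x
      have hx1 : x ^ 2 ≤ 4 * R ^ 2 := by
        rw [← sq_abs]; nlinarith [abs_nonneg x]
      calc _ ≤ P * (1 + 4 * R ^ 2) := by gcongr
        _ ≤ K := by rw [hK]; linarith
  refine (lintegral_mono hpt).trans_lt ?_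
  exact (integrable_inv_one_add_sq.const_mul K).lintegral_lt_top

/-! ### The maximal function dominates the function -/

lemma convolution_dilation_eq_integral_comp_sub (Φ : 𝓢(ℝ, ℂ)) (f : ℝ → ℂ) {s : ℝ} (hs : 0 < s)
    (x : ℝ) : (f ⋆[ContinuousLinearMap.mul ℂ ℂ, volume] dilation Φ s) x
      = ∫ u, Φ u * f (x - s * u) := by
  rw [convolution_dilation_apply, ← integral_dilation_mul Φ (fun z => f (x - z)) hs,
    ← integral_sub_left_eq_self (fun z => dilation Φ s z * f (x - z)) volume x]
  simp only [sub_sub_cancel, mul_comm]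

/-- As `s → 0⁺`, `f * Φ_s (x)` tends to `(∫ Φ) * f x` at a continuity point, and each value is at
most the supremum. -/
lemma mul_enorm_le_smoothMaximal (Φ : 𝓢(ℝ, ℂ)) {f : ℝ → ℂ} (hm : Measurable f) {B : ℝ}
    (hB : ∀ y, ‖f y‖ ≤ B) {x : ℝ} (hx : ContinuousAt f x) :
    ‖∫ u, Φ u‖ₑ * ‖f x‖ₑ ≤ smoothMaximal Φ f x := by
  have hlim : Tendsto (fun s : ℝ => ∫ u, Φ u * f (x - s * u)) (𝓝[>] 0)
      (𝓝 (∫ u, Φ u * f x)) := by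
    refine tendsto_integral_filter_of_dominated_convergence (fun u => ‖Φ u‖ * B)
      (Eventually.of_forall fun s => ?_)
      (Eventually.of_forall fun s => Eventually.of_forall fun u => ?_)
      (Φ.integrable.norm.mul_const B) (Eventually.of_forall fun u => ?_)
    · exact (Φ.continuous.measurable.mul (hm.comp (by fun_prop))).aestronglyMeasurable
    · rw [norm_mul]
      gcongr
      exact hB _
    · have h1 : Tendsto (fun s : ℝ => x - s * u) (𝓝[>] 0) (𝓝 x) := by
        have h2 : Continuous fun s : ℝ => x - s * u := by fun_prop
        simpa using (h2.tendsto 0).mono_left nhdsWithin_le_nhds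
      exact (hx.tendsto.comp h1).const_mul _
  rw [integral_mul_const] at hlim
  rw [← enorm_mul]
  refine le_of_tendsto hlim.enorm ?_
  filter_upwards [self_mem_nhdsWithin] with s hs
  rw [← convolution_dilation_eq_integral_comp_sub Φ f hs]
  exact le_iSup₂ (f := fun (r : ℝ) (_ : 0 < r) =>
      ‖(f ⋆[ContinuousLinearMap.mul ℂ ℂ, volume] dilation Φ r) x‖ₑ) s hs

/-! ### The truncated kernel `1 / x` -/

/-- The function `x⁻¹` truncated to `1 < |x| ≤ R`. -/
noncomputable def truncatedInv (R x : ℝ) : ℂ := if 1 < |x| ∧ |x| ≤ R then (x : ℂ)⁻¹ else 0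

lemma measurable_truncatedInv (R : ℝ) : Measurable (truncatedInv R) := by
  refine Measurable.ite ?_ (by fun_prop) measurable_const
  exact (measurableSet_lt measurable_const continuous_abs.measurable).inter
    (measurableSet_le continuous_abs.measurable measurable_const)

lemma norm_truncatedInv_le (R x : ℝ) : ‖truncatedInv R x‖ ≤ 1 := by
  unfold truncatedInv
  split_ifs with h
  · rw [norm_inv, Complex.norm_real]
    exact inv_le_one_of_one_le₀ h.1.le
  · simp

lemma truncatedInv_eq_zero {R x : ℝ} (h : R < |x|) : truncatedInv R x = 0 :=
  if_neg fun h' => absurd h'.2 (not_le.2 h)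

lemma integrable_truncatedInv (R : ℝ) : Integrable (truncatedInv R) := by
  have h : Integrable ((Icc (-R) R).indicator fun _ => (1 : ℝ)) :=
    (integrable_indicator_iff measurableSet_Icc).2 (integrableOn_const (by simp))
  refine h.mono' (measurable_truncatedInv R).aestronglyMeasurable (Eventually.of_forall fun x => ?_)
  by_cases hx : |x| ≤ R
  · rw [indicator_of_mem (mem_Icc.2 (abs_le.1 hx))]
    exact norm_truncatedInv_le R x
  · rw [truncatedInv_eq_zero (not_le.1 hx), norm_zero]
    exact indicator_nonneg (fun _ _ => zero_le_one) _

lemma integral_truncatedInv (R : ℝ) : ∫ x, truncatedInv R x = 0 := by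
  have hodd : ∀ x, truncatedInv R (-x) = -truncatedInv R x := by
    intro x
    simp only [truncatedInv, abs_neg]
    split_ifs
    · push_cast
      rw [inv_neg]
    · simp
  have h := integral_neg_eq_self (truncatedInv R) volume
  simp only [hodd, integral_neg] at h
  exact self_eq_neg.1 h.symm

lemma hardyNorm_truncatedInv_lt_top (Φ : 𝓢(ℝ, ℂ)) (R : ℝ) :
    hardyNorm Φ (truncatedInv R) < ∞ :=
  hardyNorm_lt_top_of_bounded_of_mean_zero Φ (integrable_truncatedInv R) (integral_truncatedInv R)
    (norm_truncatedInv_le R) (le_max_left 1 R)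
    fun _ hy => truncatedInv_eq_zero ((le_max_right 1 R).trans_lt hy)

lemma memHardy_truncatedInv (Φ : 𝓢(ℝ, ℂ)) (R : ℝ) : MemHardy Φ (truncatedInv R) :=
  ⟨integrable_truncatedInv R, hardyNorm_truncatedInv_lt_top Φ R⟩

/-- Homogeneity of degree `-1`: only the cutoffs move. -/
lemma dilation_truncatedInv (R : ℝ) {t : ℝ} (ht : 0 < t) (x : ℝ) :
    dilation (truncatedInv R) t x = if t < |x| ∧ |x| ≤ R * t then (x : ℂ)⁻¹ else 0 := by
  have ht' : (t : ℂ) ≠ 0 := by exact_mod_cast ht.ne'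
  simp only [dilation, truncatedInv, abs_div, abs_of_pos ht, one_lt_div ht, div_le_iff₀ ht]
  split_ifs
  · push_cast
    rw [inv_div, div_eq_mul_inv, inv_mul_cancel_left₀ ht']
  · simp

/-- Each side is `1/x` times `1_{1<|x|≤Rt} - 1_{1<|x|≤t} - 1_{1<|x|≤R}`, which is symmetric in `R`
and `t`. The exchange trades the large parameter `R` for the fixed `t` in the truncation. -/
lemma dilation_truncatedInv_sub {R t : ℝ} (hR : 1 ≤ R) (ht : 1 ≤ t) :
    dilation (truncatedInv R) t - truncatedInv R
      = dilation (truncatedInv t) R - truncatedInv t := by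
  ext x
  have h1 : R ≤ R * t := le_mul_of_one_le_right (by linarith) ht
  have h2 : t ≤ R * t := le_mul_of_one_le_left (by linarith) hR
  simp only [Pi.sub_apply, dilation_truncatedInv R (by linarith : 0 < t),
    dilation_truncatedInv t (by linarith : 0 < R), truncatedInv, mul_comm t R]
  split_ifs <;> grind

lemma dilation_dilation_inv (f : ℝ → ℂ) {t : ℝ} (ht : 0 < t) :
    dilation (dilation f t⁻¹) t = f := by
  have ht' : (t : ℂ) ≠ 0 := by exact_mod_cast ht.ne'
  ext x
  simp only [dilation, Complex.ofReal_inv, inv_inv]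
  rw [inv_mul_cancel_left₀ ht', div_inv_eq_mul, div_mul_cancel₀ _ ht.ne']

/-- The truncated kernels are almost invariant under dilations: the defect is bounded
independently of the truncation. -/
lemma hardyNorm_dilation_truncatedInv_sub_le (Φ : 𝓢(ℝ, ℂ)) {R t : ℝ} (hR : 1 ≤ R) (ht : 0 < t) :
    hardyNorm Φ (dilation (truncatedInv R) t - truncatedInv R)
      ≤ 2 * hardyNorm Φ (truncatedInv (max t t⁻¹)) := by
  have hbig : ∀ r : ℝ, 1 ≤ r → hardyNorm Φ (dilation (truncatedInv R) r - truncatedInv R)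
      ≤ 2 * hardyNorm Φ (truncatedInv r) := by
    intro r hr
    rw [dilation_truncatedInv_sub hR hr, two_mul]
    refine (hardyNorm_sub_le Φ (integrable_dilation (integrable_truncatedInv r) (by linarith))
      (integrable_truncatedInv r)).trans ?_
    gcongr
    exact hardyNorm_dilation_le Φ (integrable_truncatedInv r) (by linarith)
  rcases le_total 1 t with h | h
  · rw [max_eq_left ((inv_le_one_of_one_le₀ h).trans h)]
    exact hbig t h
  · have h' : 1 ≤ t⁻¹ := (one_le_inv₀ ht).2 h
    rw [max_eq_right (h.trans h')]
    refine le_trans ?_ (hbig t⁻¹ h')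
    -- For `t ≤ 1`, the defect at `t` is minus the `t`-dilate of the defect at `t⁻¹`.
    set g := dilation (truncatedInv R) t⁻¹ - truncatedInv R with hg
    have hrw : dilation (truncatedInv R) t - truncatedInv R = (-1 : ℂ) • dilation g t := by
      have h1 : dilation g t = dilation (dilation (truncatedInv R) t⁻¹) t
          - dilation (truncatedInv R) t := by
        ext x
        simp only [hg, dilation, Pi.sub_apply, mul_sub]
      rw [h1, dilation_dilation_inv _ ht, neg_one_smul, neg_sub]
    rw [hrw, hardyNorm_smul, enorm_neg, enorm_one, one_mul]
    exact hardyNorm_dilation_le Φ ((integrable_dilation (integrable_truncatedInv R)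
      (inv_pos.2 ht).ne').sub (integrable_truncatedInv R)) ht

/-- On `(1, R)` the maximal function is at least `|∫ Φ| / x`, whose integral is logarithmic. -/
lemma le_hardyNorm_truncatedInv (Φ : 𝓢(ℝ, ℂ)) {R : ℝ} (hR : 1 ≤ R) :
    ‖∫ u, Φ u‖ₑ * ENNReal.ofReal (Real.log R) ≤ hardyNorm Φ (truncatedInv R) := by
  have hpt : ∀ x ∈ Ioo 1 R, ‖∫ u, Φ u‖ₑ * ENNReal.ofReal x⁻¹ ≤ smoothMaximal Φ (truncatedInv R) x := by
    intro x hx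
    have hx0 : 0 < x := by linarith [hx.1]
    have heq : (fun y : ℝ => (y : ℂ)⁻¹) =ᶠ[𝓝 x] truncatedInv R := by
      filter_upwards [Ioo_mem_nhds hx.1 hx.2] with y hy
      have hy0 : 0 < y := by linarith [hy.1]
      rw [truncatedInv, abs_of_pos hy0, if_pos ⟨hy.1, hy.2.le⟩]
    have hcont : ContinuousAt (truncatedInv R) x := by
      refine ContinuousAt.congr ?_ heq
      exact Complex.continuous_ofReal.continuousAt.inv₀ (by exact_mod_cast hx0.ne')
    have h := mul_enorm_le_smoothMaximal Φ (measurable_truncatedInv R) (norm_truncatedInv_le R) hcont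
    rwa [← heq.eq_of_nhds, ← ofReal_norm (x : ℂ)⁻¹, norm_inv, Complex.norm_of_nonneg hx0.le] at h
  have hlog : ENNReal.ofReal (Real.log R) = ∫⁻ x in Ioo 1 R, ENNReal.ofReal x⁻¹ := by
    rw [← ofReal_integral_eq_lintegral_ofReal, ← integral_Ioc_eq_integral_Ioo,
      ← intervalIntegral.integral_of_le hR, integral_inv_of_pos one_pos (by linarith), div_one]
    · have h : ContinuousOn (fun x : ℝ => x⁻¹) (Icc 1 R) :=
        continuousOn_inv₀.mono fun x hx => by
          have : (1 : ℝ) ≤ x := hx.1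
          simp only [mem_compl_iff, mem_singleton_iff]; linarith
      exact (h.integrableOn_Icc).mono_set Ioo_subset_Icc_self
    · filter_upwards [ae_restrict_mem measurableSet_Ioo] with x hx
      have : 1 < x := hx.1
      simp only [Pi.zero_apply, inv_nonneg]; linarith
  rw [hlog, ← lintegral_const_mul' _ _ enorm_ne_top]
  exact (setLIntegral_mono' measurableSet_Ioo hpt).trans (setLIntegral_le_lintegral _ _)

lemma tendsto_hardyNorm_truncatedInv (Φ : 𝓢(ℝ, ℂ)) (hΦ : (∫ x, Φ x) ≠ 0) :
    Tendsto (fun R => hardyNorm Φ (truncatedInv R)) atTop (𝓝 ∞) := by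
  have h : Tendsto (fun R => ‖∫ u, Φ u‖ₑ * ENNReal.ofReal (Real.log R)) atTop (𝓝 ∞) := by
    have h1 : Tendsto (fun R => ENNReal.ofReal (Real.log R)) atTop (𝓝 ∞) :=
      ENNReal.tendsto_ofReal_atTop.comp Real.tendsto_log_atTop
    have h2 := ENNReal.Tendsto.const_mul (a := ‖∫ u, Φ u‖ₑ) h1 (Or.inl ENNReal.top_ne_zero)
    rwa [ENNReal.mul_top (enorm_ne_zero.2 hΦ)] at h2
  refine tendsto_of_tendsto_of_tendsto_of_le_of_le' h tendsto_const_nhds ?_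
    (Eventually.of_forall fun _ => le_top)
  filter_upwards [eventually_ge_atTop 1] with R hR using le_hardyNorm_truncatedInv Φ hR

/-! ### The operator norm -/

/-- Triangle inequality for `A • f = H f - (H f - A • f)` with `A = ∫ φ`; Minkowski with `c = -1`
bounds the second term. -/
lemma enorm_integral_mul_hardyNorm_le (Φ : 𝓢(ℝ, ℂ)) {φ f : ℝ → ℂ} (hφ : IntegrableOn φ (Ioi 0))
    (hf : Integrable f) :
    ‖∫ t in Ioi (0 : ℝ), φ t‖ₑ * hardyNorm Φ f ≤ hardyNorm Φ (hausdorffOp φ f)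
      + ∫⁻ t in Ioi (0 : ℝ), ‖φ t‖ₑ * hardyNorm Φ (dilation f t - f) := by
  have hT := integrable_hausdorffOp hφ hf
  set A := ∫ t in Ioi (0 : ℝ), φ t with hA
  have h := hardyNorm_hausdorffOp_add_le Φ hφ hf (-1)
  simp only [← hA, neg_one_mul, neg_smul, one_smul, ← sub_eq_add_neg] at h
  rw [← hardyNorm_smul]
  calc hardyNorm Φ (A • f) = hardyNorm Φ (hausdorffOp φ f - (hausdorffOp φ f - A • f)) := by
        rw [sub_sub_cancel]
    _ ≤ _ := (hardyNorm_sub_le Φ hT (hT.sub (hf.smul A))).trans (add_le_add_right h _)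

/-- Dominated convergence: for fixed `t` the defect stays bounded while the norm blows up, and
contractivity of dilations gives the majorant `2 * ‖φ t‖`. -/
lemma tendsto_lintegral_hardyNorm_dilation_sub_div (Φ : 𝓢(ℝ, ℂ)) (hΦ : (∫ x, Φ x) ≠ 0)
    {φ : ℝ → ℂ} (hφ : IntegrableOn φ (Ioi 0)) :
    Tendsto (fun R => ∫⁻ t in Ioi (0 : ℝ), ‖φ t‖ₑ *
      hardyNorm Φ (dilation (truncatedInv R) t - truncatedInv R)
        * (hardyNorm Φ (truncatedInv R))⁻¹) atTop (𝓝 0) := by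
  have hmeas : ∀ R : ℝ, AEMeasurable (fun t => ‖φ t‖ₑ *
      hardyNorm Φ (dilation (truncatedInv R) t - truncatedInv R)
        * (hardyNorm Φ (truncatedInv R))⁻¹) (volume.restrict (Ioi 0)) := by
    intro R
    have h := (aemeasurable_smoothMaximal_dilation_add Φ (integrable_truncatedInv R)
      (-1)).lintegral_prod_left'
    simp only [neg_one_smul, ← sub_eq_add_neg] at h
    exact (hφ.aestronglyMeasurable.enorm.mul h).mul_const _
  have hinv : Tendsto (fun R => (hardyNorm Φ (truncatedInv R))⁻¹) atTop (𝓝 0) := by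
    simpa using (tendsto_hardyNorm_truncatedInv Φ hΦ).inv
  rw [← lintegral_zero (μ := volume.restrict (Ioi (0 : ℝ)))]
  refine tendsto_lintegral_filter_of_dominated_convergence' (fun t => ‖φ t‖ₑ * 2)
    (Eventually.of_forall hmeas) (Eventually.of_forall fun R => ?_) ?_ ?_
  · filter_upwards [ae_restrict_mem measurableSet_Ioi] with t ht
    have ht : 0 < t := ht
    have h : hardyNorm Φ (dilation (truncatedInv R) t - truncatedInv R)
        ≤ 2 * hardyNorm Φ (truncatedInv R) := by
      rw [two_mul]
      refine (hardyNorm_sub_le Φ (integrable_dilation (integrable_truncatedInv R) ht.ne')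
        (integrable_truncatedInv R)).trans ?_
      gcongr
      exact hardyNorm_dilation_le Φ (integrable_truncatedInv R) ht
    rw [mul_assoc]
    gcongr
    -- This also covers a vanishing norm, as happens for `R ≤ 1`: then the defect vanishes too, and
    -- `0 * ∞ = 0`.
    exact ENNReal.div_le_of_le_mul h
  · rw [lintegral_mul_const' _ _ (by simp)]
    exact ENNReal.mul_ne_top hφ.2.ne (by simp)
  · filter_upwards [ae_restrict_mem measurableSet_Ioi] with t ht
    have hb : ‖φ t‖ₑ * (2 * hardyNorm Φ (truncatedInv (max t t⁻¹))) ≠ ∞ :=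
      ENNReal.mul_ne_top enorm_ne_top
        (ENNReal.mul_ne_top (by simp) (hardyNorm_truncatedInv_lt_top Φ _).ne)
    have hlim := ENNReal.Tendsto.const_mul hinv (Or.inr hb)
    rw [mul_zero] at hlim
    refine tendsto_of_tendsto_of_tendsto_of_le_of_le' tendsto_const_nhds hlim
      (Eventually.of_forall fun _ => zero_le) ?_
    filter_upwards [eventually_ge_atTop 1] with R hR
    gcongr
    exact hardyNorm_dilation_truncatedInv_sub_le Φ hR ht

theorem corollary1p1 (Φ : 𝓢(ℝ, ℂ)) (hΦ : (∫ x, Φ x) ≠ 0)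
    (φ : ℝ → ℂ) (hφ : IntegrableOn φ (Ioi (0 : ℝ))) :
    (∀ f, MemHardy Φ f →
      ∀ᵐ x : ℝ, IntegrableOn (fun t : ℝ => f (x / t) * (φ t / (t : ℂ))) (Ioi (0 : ℝ))) ∧
    BoundedOnHardy Φ (hausdorffOp φ) ∧
    ENNReal.ofReal ‖∫ t in Ioi (0 : ℝ), φ t‖ ≤ hardyOpNorm Φ (hausdorffOp φ) ∧
    hardyOpNorm Φ (hausdorffOp φ) ≤ ENNReal.ofReal (∫ t in Ioi (0 : ℝ), ‖φ t‖) := by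
  have hfin : ∫⁻ t in Ioi (0 : ℝ), ‖φ t‖ₑ ≠ ∞ := hφ.2.ne
  refine ⟨fun f hf => (integrable_hausdorff_kernel hφ hf.1).prod_right_ae, ?_, ?_, ?_⟩
  · refine ⟨(∫⁻ t in Ioi (0 : ℝ), ‖φ t‖ₑ).toNNReal, fun f hf => ?_⟩
    have h := hardyNorm_hausdorffOp_le Φ hφ hf.1
    rw [ENNReal.coe_toNNReal hfin]
    exact ⟨⟨integrable_hausdorffOp hφ hf.1,
      h.trans_lt (ENNReal.mul_lt_top hfin.lt_top hf.2)⟩, h⟩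
  · rw [ofReal_norm]
    refine le_sInf fun C hC => ?_
    -- Testing an admissible `C` on `truncatedInv R` and dividing by its norm, eventually nonzero,
    -- leaves `C` plus a term tending to `0`.
    have hlim := (tendsto_lintegral_hardyNorm_dilation_sub_div Φ hΦ hφ).const_add C
    rw [add_zero] at hlim
    refine ge_of_tendsto hlim ?_
    filter_upwards [(tendsto_hardyNorm_truncatedInv Φ hΦ).eventually
      (lt_mem_nhds ENNReal.zero_lt_top)] with R hR
    have hR' := (hardyNorm_truncatedInv_lt_top Φ R).ne
    have h := (enorm_integral_mul_hardyNorm_le Φ hφ (integrable_truncatedInv R)).trans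
      (add_le_add_left (hC _ (memHardy_truncatedInv Φ R)) _)
    rw [lintegral_mul_const' _ _ (ENNReal.inv_ne_top.2 hR.ne')]
    calc ‖∫ t in Ioi (0 : ℝ), φ t‖ₑ
        = ‖∫ t in Ioi (0 : ℝ), φ t‖ₑ * hardyNorm Φ (truncatedInv R)
            * (hardyNorm Φ (truncatedInv R))⁻¹ := by
          rw [mul_assoc, ENNReal.mul_inv_cancel hR.ne' hR', mul_one]
      _ ≤ _ := mul_le_mul_left h _
      _ = _ := by rw [add_mul, mul_assoc, ENNReal.mul_inv_cancel hR.ne' hR', mul_one]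
  · refine sInf_le fun f hf => ?_
    rw [integral_norm_eq_lintegral_enorm hφ.aestronglyMeasurable, ENNReal.ofReal_toReal hfin]
    exact hardyNorm_hausdorffOp_le Φ hφ hf.1
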